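/- Let $d\ge 2$, $m\ge 1$, $\mu>0$, $\lambda\in(0,1)$, $\tau>0$, $\kappa>0$. Let $Y=(-\tfrac12,\tfrac12)^d$, let $\omega\subset Y$ be a simply connected Lipschitz domain with $\mathrm{dist}(\omega,\partial Y)>0$, and let $\Omega\subset\mathbb R^d$ be a bounded Lipschitz domain. For $\varepsilon\in(0,1)$ and $\mathbf n\in\mathbb Z^d$ put $\omega_\varepsilon^{\mathbf n}=\varepsilon(\mathbf n+\omega)$, $$D_\varepsilon=\bigcup\{\omega_\varepsilon^{\mathbf n}:\ \omega_\varepsilon^{\mathbf n}\subset\Omega,\ \mathrm{dist}(\omega_\varepsilon^{\mathbf n},\partial\Omega)>\kappa\varepsilon\},\qquad \Omega_\varepsilon=\Omega\setminus\overline{D_\varepsilon},$$ and, for $\delta>0$, $\Lambda_{\varepsilon,\delta}=\delta\mathbf 1_{D_\varepsilon}+\mathbf 1_{\Omega_\varepsilon}$. Let $A=(a_{ij}^{\alpha\beta})$, $1\le i,j\le d$, $1\le\alpha,\beta\le m$, be a real coefficient field on $\mathbb R^d$ such that, for all $y,w\in\mathbb R^d$, $\xi\in\mathbb R^{dm}$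 and $\mathbf n\in\mathbb Z^d$ (with summation over repeated indices), $a_{ij}^{\alpha\beta}(y)=a_{ji}^{\beta\alpha}(y)$, $\mu|\xi|^2\le a_{ij}^{\alpha\beta}(y)\xi_i^\alpha\xi_j^\beta\le\mu^{-1}|\xi|^2$, $A(y+\mathbf n)=A(y)$ and $|A(y)-A(w)|\le\tau|y-w|^\lambda$. Set $$\mathcal L_{\varepsilon,\delta}u=-\mathrm{div}\big(\Lambda_{\varepsilon,\delta}(x)A(x/\varepsilon)\nabla u\big),$$ and write $Q_R=Q_R(x_0)=\{x\in\mathbb R^d:\|x-x_0\|_\infty<R\}$. For every integer $\ell\ge1$ there is a constant $C_\ell>0$, depending only on $\ell,d,m,\mu,\lambda,\tau,\kappa,\omega$ and $\Omega$, such that the following holds for every such $A$, all $\varepsilon\in(0,1)$ and $\delta\in(1,\infty)$, every $R\ge 32\varepsilon$ and every cube $Q_R=Q_R(x_0)\subset\Omega$. If $f\in L^2(Q_R;\mathbb R^m)$ and $u\in H^1(Q_R;\mathbb R^m)$ is a weak solution of $\mathcal L_{\varepsilon,\delta}u=f$ in $Q_R$, then $$\int_{Q_{R/2}}|\nabla u|^2\le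 C_\ell\left\{\frac1{R^2}\int_{Q_R}|u|^2+\Big(\frac{\varepsilon}{R}\Big)^{2\ell}\int_{Q_R}|\nabla u|^2+R^2\int_{Q_R}|f|^2\right\}.$$ -/

import Mathlib

open MeasureTheory Set
open scoped ENNReal NNReal

noncomputable section

namespace HighContrast

/-- The Euclidean space `ℝⁿ`. -/
abbrev Vec (n : ℕ) : Type := EuclideanSpace ℝ (Fin n)

/-- The space `ℝ^{d × m}` of gradients of maps `ℝᵈ → ℝᵐ`, with its Euclidean norm; the entry
`(j, β)` of a gradient is `∂_j u^β`. -/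
abbrev Grad (d m : ℕ) : Type := EuclideanSpace ℝ (Fin d × Fin m)

/-- Coefficient fields `A = (a_{ij}^{αβ})` on `ℝᵈ`, with `a_{ij}^{αβ}(y) = A y (i, α) (j, β)`. -/
abbrev Coeff (d m : ℕ) : Type := Vec d → Matrix (Fin d × Fin m) (Fin d × Fin m) ℝ

/-- The point of `ℝᵈ` given by an integer vector. -/
def latticePt {d : ℕ} (n : Fin d → ℤ) : Vec d := WithLp.toLp 2 (fun i => (n i : ℝ))

/-- The open cube `Q_R(x₀) = {x : ‖x - x₀‖_∞ < R}`. -/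
def cube {d : ℕ} (x₀ : Vec d) (R : ℝ) : Set (Vec d) := {x | ∀ i, |x i - x₀ i| < R}

/-- The unit cell `Y = (-1/2, 1/2)ᵈ`. -/
def unitCell (d : ℕ) : Set (Vec d) := cube 0 (1 / 2)

/-- The distance `inf {|x - y| : x ∈ s, y ∈ t}` between two sets. -/
def setDist {d : ℕ} (s t : Set (Vec d)) : ℝ≥0∞ := ⨅ x ∈ s, Metric.infEDist x t

/-- `A y ξ · η = a_{ij}^{αβ}(y) ξ_j^β η_i^α`. -/
def coeffForm {d m : ℕ} (A : Coeff d m) (y : Vec d) (ξ η : Grad d m) : ℝ :=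
  ∑ i : Fin d, ∑ j : Fin d, ∑ α : Fin m, ∑ β : Fin m, A y (i, α) (j, β) * ξ (j, β) * η (i, α)

/-- The standing assumptions on the coefficients: symmetry, strong ellipticity with constant `μ`,
`ℤᵈ`-periodicity, and Hölder continuity with exponent `lam` and constant `τ`. -/
structure CoeffAssumptions {d m : ℕ} (μ lam τ : ℝ) (A : Coeff d m) : Prop where
  symmetry : ∀ (y : Vec d) (i j : Fin d) (α β : Fin m), A y (i, α) (j, β) = A y (j, β) (i, α)
  elliptic : ∀ (y : Vec d) (ξ : Grad d m),
    μ * ‖ξ‖ ^ 2 ≤ coeffForm A y ξ ξ ∧ coeffForm A y ξ ξ ≤ μ⁻¹ * ‖ξ‖ ^ 2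
  periodic : ∀ (y : Vec d) (n : Fin d → ℤ), A (y + latticePt n) = A y
  holder : ∀ y w : Vec d,
    √(∑ p : Fin d × Fin m, ∑ q : Fin d × Fin m, (A y p q - A w p q) ^ 2) ≤ τ * ‖y - w‖ ^ lam

/-- A Lipschitz domain: a connected open set which near each of its boundary points is, in
suitable orthonormal coordinates, the region above the graph of a Lipschitz function. The unit
vector `ν` is the vertical direction, and `x - ⟪ν, x⟫ ν` the horizontal part of `x`. -/
structure IsLipschitzDomain {d : ℕ} (U : Set (Vec d)) : Prop where
  isOpen : IsOpen U
  isConnected : IsConnected U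
  boundary : ∀ x₀ ∈ frontier U, ∃ r : ℝ, 0 < r ∧ ∃ ν : Vec d, ‖ν‖ = 1 ∧
    ∃ (K : ℝ≥0) (ψ : Vec d → ℝ), LipschitzWith K ψ ∧
      ∀ x ∈ Metric.ball x₀ r, x ∈ U ↔ ψ (x - inner ℝ ν x • ν) < inner ℝ ν x

/-- The standing assumptions on the model inclusion `ω`: a simply connected Lipschitz domain
in the unit cell `Y`, at positive distance from `∂Y`. -/
structure InclusionAssumptions {d : ℕ} (ω : Set (Vec d)) : Prop where
  lipschitz : IsLipschitzDomain ω
  simplyConnected : IsSimplyConnected ω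
  subset_cell : ω ⊆ unitCell d
  dist_pos : 0 < setDist ω (frontier (unitCell d))

/-- The rescaled inclusion `ω_ε^n = ε (n + ω)`. -/
def inclusion {d : ℕ} (ω : Set (Vec d)) (ε : ℝ) (n : Fin d → ℤ) : Set (Vec d) :=
  (fun y : Vec d => ε • (latticePt n + y)) '' ω

/-- The indices `n ∈ ℤᵈ` with `ω_ε^n ⊆ Ω` and `dist(ω_ε^n, ∂Ω) > κ ε`. -/
def indexSet {d : ℕ} (Ω ω : Set (Vec d)) (κ ε : ℝ) : Set (Fin d → ℤ) :=
  {n | inclusion ω ε n ⊆ Ω ∧ ENNReal.ofReal (κ * ε) < setDist (inclusion ω ε n) (frontier Ω)}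

/-- The union `D_ε` of the inclusions. -/
def inclusions {d : ℕ} (Ω ω : Set (Vec d)) (κ ε : ℝ) : Set (Vec d) :=
  ⋃ n ∈ indexSet Ω ω κ ε, inclusion ω ε n

/-- The contrast function `Λ_{ε,δ} = δ 1_{D_ε} + 1_{Ω_ε}`, with `Ω_ε = Ω \ closure D_ε`. -/
def contrast {d : ℕ} (Ω ω : Set (Vec d)) (κ ε δ : ℝ) (x : Vec d) : ℝ :=
  δ * (inclusions Ω ω κ ε).indicator (fun _ => (1 : ℝ)) x +
    (Ω \ closure (inclusions Ω ω κ ε)).indicator (fun _ => (1 : ℝ)) x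

/-- Smooth test functions with compact support in `U`. -/
structure IsTestFunction {d : ℕ} {F : Type*} [NormedAddCommGroup F] [NormedSpace ℝ F]
    (U : Set (Vec d)) (φ : Vec d → F) : Prop where
  smooth : ContDiff ℝ (⊤ : ℕ∞) φ
  hasCompactSupport : HasCompactSupport φ
  tsupport_subset : tsupport φ ⊆ U

/-- The classical partial derivative `∂_i φ`. -/
def pderiv {d : ℕ} {F : Type*} [NormedAddCommGroup F] [NormedSpace ℝ F]
    (i : Fin d) (φ : Vec d → F) (x : Vec d) : F :=
  fderiv ℝ φ x (EuclideanSpace.single i 1)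

/-- The classical gradient of a smooth map, with entries `∂_i φ^α`. -/
def classicalGrad {d m : ℕ} (φ : Vec d → Vec m) (x : Vec d) : Grad d m :=
  WithLp.toLp 2 (fun p : Fin d × Fin m => pderiv p.1 φ x p.2)

/-- `u ∈ H¹(U; ℝᵐ)` with weak gradient `Du`: both are square integrable on `U`, and `Du` satisfies
the integration by parts formula against all smooth test functions with compact support in `U`. -/
structure IsH1With {d m : ℕ} (U : Set (Vec d)) (u : Vec d → Vec m) (Du : Vec d → Grad d m) :
    Prop where
  memLp : MemLp u 2 (volume.restrict U)
  memLp_grad : MemLp Du 2 (volume.restrict U)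
  integral_eq : ∀ φ : Vec d → ℝ, IsTestFunction U φ → ∀ (i : Fin d) (α : Fin m),
    ∫ x in U, u x α * pderiv i φ x = -∫ x in U, Du x (i, α) * φ x

/-- The map `u`, with weak gradient `Du`, solves weakly in `U` the system
`-div (Λ_{ε,δ}(x) A(x/ε) ∇u) = f`. -/
def IsWeakSolution {d m : ℕ} (Ω ω : Set (Vec d)) (κ ε δ : ℝ) (A : Coeff d m)
    (U : Set (Vec d)) (u : Vec d → Vec m) (Du : Vec d → Grad d m) (f : Vec d → Vec m) : Prop :=
  IsH1With U u Du ∧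
    ∀ φ : Vec d → Vec m, IsTestFunction U φ →
      ∫ x in U, contrast Ω ω κ ε δ x * coeffForm A (ε⁻¹ • x) (Du x) (classicalGrad φ x) =
        ∫ x in U, inner ℝ (f x) (φ x)

end HighContrast

end

namespace HighContrast

section

open Filter Topology Convolution Pointwise

/-! The estimate is Caccioppoli's inequality, and the only danger is the contrast: testing with `η²
u` produces an error `Λ |∇η|² |u|²`, which on the inclusions carries the large factor `δ`. The
remedy is a cutoff whose gradient vanishes on every inclusion. Then the error lives where `Λ = 1`,
and the bound is uniform in `ε` and `δ`, even without the term in `(ε/R)^(2l)`.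

Such a cutoff exists because `ω` stays away from the boundary of its cell. In each coordinate, `t`
is replaced by `ε * staircase c (t / ε)`, which is constant on the range of that coordinate over
each inclusion, has bounded slope, and differs from `t` by at most `ε ≤ R / 32`. A fixed bump at
scale `R` composed with this still has derivative `O(1/R)`; products over the coordinates give
`exists_cutoff`.

Two points of rigour remain. The weak formulation admits only smooth test fields, so `η² u` is
reached by mollification (`IsH1With.integral_test_mul`). On the boundary of the inclusions
`contrast` is neither `1` nor `δ`, so that boundary must be null (`ae_contrast`). The inequality is
then assembled in `caccioppoli_of_cutoff`. -/

/-! ### Correlations in `L²` and weak convergence of mollifications. -/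

theorem integral_mul_translate_eq_inner {d : ℕ} {F G : Vec d → ℝ} (hF : MemLp F 2 volume)
    (hG : MemLp G 2 volume) (z : Vec d) :
    ∫ x, F x * G (x + z) = inner ℝ (hF.toLp F) (DomAddAct.mk z +ᵥ hG.toLp G) := by
  rw [DomAddAct.mk_vadd_toLp, L2.inner_def]
  refine integral_congr_ae ?_
  filter_upwards [hF.coeFn_toLp, (hG.comp_measurePreserving (measurePreserving_vadd z volume)).coeFn_toLp]
    with x h1 h2
  simp only [Function.comp_def, vadd_eq_add] at h2
  rw [h1]
  erw [h2]
  simp [mul_comm, add_comm]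

/-- Translations act continuously on `Lp` for finite exponents, and the correlation is an inner
product against a translated class. -/
theorem continuous_integral_mul_translate {d : ℕ} {F G : Vec d → ℝ} (hF : MemLp F 2 volume)
    (hG : MemLp G 2 volume) : Continuous fun z => ∫ x, F x * G (x + z) := by
  simp_rw [integral_mul_translate_eq_inner hF hG]
  have : Fact ((2 : ℝ≥0∞) ≠ ∞) := ⟨by norm_num⟩
  have h : Continuous fun z : Vec d => (DomAddAct.mk z +ᵥ hG.toLp G : Lp ℝ 2 (volume : Measure (Vec d))) :=
    (DomAddAct.continuous_mk).vadd continuous_const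
  exact continuous_const.inner h

theorem memLp_translate {d : ℕ} {G : Vec d → ℝ} (hG : MemLp G 2 volume) (z : Vec d) :
    MemLp (fun x => G (x + z)) 2 volume :=
  hG.comp_measurePreserving (measurePreserving_add_right volume z)

/-- The pairing of `F` with `ρ ⋆ G` is the value at the origin of the mollified correlation. -/
theorem integral_mul_convolution {d : ℕ} {F G ρ : Vec d → ℝ} (hF : MemLp F 2 volume)
    (hG : MemLp G 2 volume) (hρ : Continuous ρ) (hρc : HasCompactSupport ρ) :
    ∫ x, F x * (ρ ⋆[ContinuousLinearMap.lsmul ℝ ℝ, volume] G) x =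
      (ρ ⋆[ContinuousLinearMap.lsmul ℝ ℝ, volume] fun z => ∫ x, F x * G (x + z)) 0 := by
  simp only [convolution_def, ContinuousLinearMap.lsmul_apply, smul_eq_mul, zero_sub,
    ← integral_const_mul]
  have hm : AEStronglyMeasurable (Function.uncurry fun x t => F x * (ρ t * G (x - t)))
      ((volume : Measure (Vec d)).prod (volume : Measure (Vec d))) :=
    (hF.aestronglyMeasurable.comp_fst (ν := (volume : Measure (Vec d)))).mul
      ((hρ.aestronglyMeasurable (μ := (volume : Measure (Vec d)))).convolution_integrand
        (μ := (volume : Measure (Vec d))) (ContinuousLinearMap.mul ℝ ℝ) hG.aestronglyMeasurable)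
  have hswap : ∫ t, ∫ x, ρ t * (F x * G (x + -t)) = ∫ t, ∫ x, F x * (ρ t * G (x - t)) := by
    simp only [mul_left_comm, sub_eq_add_neg]
  rw [hswap]
  refine integral_integral_swap ((integrable_prod_iff' hm).2 ⟨.of_forall fun t => ?_, ?_⟩)
  · have h := (hF.integrable_mul (memLp_translate hG (-t))).const_mul (ρ t)
    refine h.congr (.of_forall fun x => ?_)
    simp only [Function.uncurry_apply_pair, Pi.mul_apply, sub_eq_add_neg]; ring
  -- The integral over `x` of the absolute value is `|ρ|` times a correlation of `|F|` and `|G|`: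
  -- continuous with compact support.
  · have hc := continuous_integral_mul_translate hF.norm hG.norm
    have : Integrable (fun t => ‖ρ t‖ * ∫ x, ‖F x‖ * ‖G (x + -t)‖) (volume : Measure (Vec d)) :=
      (hρ.norm.mul (hc.comp continuous_neg)).integrable_of_hasCompactSupport hρc.norm.mul_right
    refine this.congr (.of_forall fun t => ?_)
    simp only [Function.uncurry_apply_pair, norm_mul, ← integral_const_mul, sub_eq_add_neg]
    refine integral_congr_ae (.of_forall fun x => ?_)
    simp only; ring

/-- Moving the mollifier onto the correlation reduces weak `L²` convergence to pointwise convergence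
of mollifications of a continuous function, at the origin. -/
theorem tendsto_integral_mul_convolution {d : ℕ} {F G : Vec d → ℝ} (hF : MemLp F 2 volume)
    (hG : MemLp G 2 volume) {φ : ℕ → ContDiffBump (0 : Vec d)}
    (hφ : Tendsto (fun k => (φ k).rOut) atTop (𝓝 0)) :
    Tendsto (fun k => ∫ x, F x *
      ((φ k).normed volume ⋆[ContinuousLinearMap.lsmul ℝ ℝ, volume] G) x) atTop
      (𝓝 (∫ x, F x * G x)) := by
  have h := ContDiffBump.convolution_tendsto_right_of_continuous (μ := volume) hφ
    (continuous_integral_mul_translate hF hG) 0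
  simp only [add_zero] at h
  refine h.congr fun k => ?_
  exact (integral_mul_convolution hF hG (φ k).continuous_normed
    (φ k).hasCompactSupport_normed).symm

/-! ### The staircase and one-dimensional cutoffs. -/

/-- A smooth step from `0` to `1` over the interval `[1/2 - c, 1/2 + c]`. -/
noncomputable def smoothStep (c s : ℝ) : ℝ := Real.smoothTransition ((s - (1 / 2 - c)) / (2 * c))

theorem contDiff_smoothStep (c : ℝ) : ContDiff ℝ (⊤ : ℕ∞) (smoothStep c) :=
  Real.smoothTransition.contDiff.comp (by fun_prop)

theorem smoothStep_of_le {c s : ℝ} (hc : 0 < c) (hs : s ≤ 1 / 2 - c) : smoothStep c s = 0 :=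
  Real.smoothTransition.zero_of_nonpos (div_nonpos_of_nonpos_of_nonneg (by linarith) (by linarith))

theorem smoothStep_of_ge {c s : ℝ} (hc : 0 < c) (hs : 1 / 2 + c ≤ s) : smoothStep c s = 1 :=
  Real.smoothTransition.one_of_one_le ((one_le_div (by linarith)).2 (by linarith))

/-- A smooth staircase, equal to `n` at distance less than `1/2 - c` from each integer `n`. -/
noncomputable def staircase (c t : ℝ) : ℝ := ⌊t⌋ + smoothStep c (Int.fract t)

/-- The interval reaches to the left of `n`, so one smooth formula covers the jump of the floor:
just below `n` the previous step is already `1` and the next one still `0`. -/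
theorem staircase_eq {c t : ℝ} (hc : 0 < c) {n : ℤ} (h1 : (n : ℝ) - (1 / 2 - c) < t)
    (h2 : t < n + 1) : staircase c t = n + smoothStep c (t - n) := by
  unfold staircase
  rcases le_or_gt (n : ℝ) t with h | h
  · have hfl : ⌊t⌋ = n := Int.floor_eq_iff.2 ⟨h, h2⟩
    rw [Int.fract, hfl]
  · rcases le_or_gt c (1 / 2) with hc2 | hc2
    · have hfl : ⌊t⌋ = n - 1 := Int.floor_eq_iff.2 ⟨by push_cast; linarith, by push_cast; linarith⟩
      rw [Int.fract, hfl, smoothStep_of_ge hc (by push_cast; linarith),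
        smoothStep_of_le hc (by linarith)]
      push_cast; ring
    · linarith

theorem staircase_eventuallyEq {c t : ℝ} (hc : 0 < c) {n : ℤ} (h1 : (n : ℝ) - (1 / 2 - c) < t)
    (h2 : t < n + 1) : staircase c =ᶠ[𝓝 t] fun s => n + smoothStep c (s - n) :=
  (eventually_of_mem (Ioo_mem_nhds h1 h2) fun _ hs => staircase_eq hc hs.1 hs.2)

theorem contDiff_staircase {c : ℝ} (hc : 0 < c) (hc2 : c < 1 / 2) :
    ContDiff ℝ (⊤ : ℕ∞) (staircase c) := by
  refine contDiff_iff_contDiffAt.2 fun t => ?_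
  refine ContDiffAt.congr_of_eventuallyEq ?_ (staircase_eventuallyEq hc (n := ⌊t⌋)
    (by linarith [Int.floor_le t]) (Int.lt_floor_add_one t))
  exact (contDiff_const.add ((contDiff_smoothStep c).comp
    (contDiff_id.sub contDiff_const))).contDiffAt

theorem deriv_staircase {c t : ℝ} (hc : 0 < c) {n : ℤ} (h1 : (n : ℝ) - (1 / 2 - c) < t)
    (h2 : t < n + 1) : deriv (staircase c) t = deriv (smoothStep c) (t - n) := by
  rw [(staircase_eventuallyEq hc h1 h2).deriv_eq, deriv_const_add, deriv_comp_sub_const]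

theorem deriv_staircase_eq_zero {c t : ℝ} (hc : 0 < c) (hc2 : c < 1 / 2) {n : ℤ}
    (h : |t - n| < 1 / 2 - c) : deriv (staircase c) t = 0 := by
  obtain ⟨h1, h2⟩ := abs_lt.1 h
  rw [deriv_staircase hc (n := n) (by linarith) (by linarith)]
  have : smoothStep c =ᶠ[𝓝 (t - n)] fun _ => 0 :=
    eventually_of_mem (Iio_mem_nhds h2) fun s hs => smoothStep_of_le hc (le_of_lt hs)
  rw [this.deriv_eq, deriv_const]

theorem exists_abs_deriv_staircase_le {c : ℝ} (hc : 0 < c) (hc2 : c < 1 / 2) :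
    ∃ K, 0 ≤ K ∧ ∀ t, |deriv (staircase c) t| ≤ K := by
  have hcont : Continuous (deriv (smoothStep c)) :=
    (contDiff_smoothStep c).continuous_deriv (by norm_num)
  obtain ⟨K, hK⟩ := (isCompact_Icc (a := (0 : ℝ)) (b := 1)).exists_bound_of_continuousOn
    hcont.continuousOn
  refine ⟨K, (norm_nonneg _).trans (hK 0 (by simp)), fun t => ?_⟩
  rw [deriv_staircase hc (n := ⌊t⌋) (by linarith [Int.floor_le t]) (Int.lt_floor_add_one t)]
  exact hK _ ⟨Int.fract_nonneg t, (Int.fract_lt_one t).le⟩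

/-- After rescaling, this says that the staircase displaces points by at most `ε`. -/
theorem abs_staircase_sub_le (c t : ℝ) : |staircase c t - t| ≤ 1 := by
  have h := Int.self_sub_floor t
  have h1 := Int.fract_nonneg t
  have h2 := Int.fract_lt_one t
  have h3 : 0 ≤ smoothStep c (Int.fract t) := Real.smoothTransition.nonneg _
  have h4 : smoothStep c (Int.fract t) ≤ 1 := Real.smoothTransition.le_one _
  unfold staircase
  rw [abs_le]; constructor <;> linarith

/-- One-dimensional cutoffs at scale `R` which are locally constant near `ε ℤ`, with derivative
`O(1/R)` uniformly in `ε`. -/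
theorem exists_cutoff_real {c : ℝ} (hc : 0 < c) (hc2 : c < 1 / 2) :
    ∃ K, 0 ≤ K ∧ ∀ ε R a : ℝ, 0 < ε → 32 * ε ≤ R → ∃ θ : ℝ → ℝ, ContDiff ℝ (⊤ : ℕ∞) θ ∧
      (∀ t, 0 ≤ θ t ∧ θ t ≤ 1) ∧ (∀ t, |t - a| < R / 2 → θ t = 1) ∧
      (∀ t, 3 * R / 4 < |t - a| → θ t = 0) ∧ (∀ t, |deriv θ t| ≤ K / R) ∧
      ∀ (t : ℝ) (n : ℤ), |t - ε * n| < ε * (1 / 2 - c) → deriv θ t = 0 := by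
  -- The radii leave room for a displacement of `1/32`: `1/2 + 1/32 ≤ 9/16` and `5/8 ≤ 3/4 - 1/32`.
  let S : ContDiffBump (0 : ℝ) := ⟨9 / 16, 5 / 8, by norm_num, by norm_num⟩
  have hS : ContDiff ℝ (⊤ : ℕ∞) (S : ℝ → ℝ) := S.contDiff
  obtain ⟨K₁, hK₁⟩ := S.hasCompactSupport.deriv.exists_bound_of_continuous
    (hS.continuous_deriv (by norm_num))
  obtain ⟨K₂, hK₂0, hK₂⟩ := exists_abs_deriv_staircase_le hc hc2
  have hK₁0 : 0 ≤ K₁ := (norm_nonneg _).trans (hK₁ 0)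
  refine ⟨K₁ * K₂, by positivity, fun ε R a hε hR => ?_⟩
  have hR0 : 0 < R := by linarith
  have hg := contDiff_staircase hc hc2
  -- The factor `ε` cancels in the derivative, which is of order `1/R`.
  let q : ℝ → ℝ := fun t => (ε * staircase c (t / ε) - a) / R
  have hq : ContDiff ℝ (⊤ : ℕ∞) q :=
    ((contDiff_const.mul (hg.comp (contDiff_id.div_const ε))).sub contDiff_const).div_const R
  have hqd : ∀ t, HasDerivAt q (deriv (staircase c) (t / ε) / R) t := fun t => by
    have h1 : HasDerivAt (staircase c) (deriv (staircase c) (t / ε)) (t / ε) :=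
      (hg.differentiable (by norm_num) _).hasDerivAt
    have h2 := (((h1.comp t ((hasDerivAt_id t).div_const ε)).const_mul ε).sub_const a).div_const R
    have e : ε * (deriv (staircase c) (t / ε) * (1 / ε)) / R = deriv (staircase c) (t / ε) / R := by
      field_simp
    exact e ▸ h2
  have hqt : ∀ t, |q t - (t - a) / R| ≤ 1 / 32 := fun t => by
    have h : q t - (t - a) / R = ε / R * (staircase c (t / ε) - t / ε) := by
      simp only [q]; field_simp; ring
    rw [h, abs_mul, abs_of_pos (by positivity)]
    calc ε / R * |staircase c (t / ε) - t / ε| ≤ ε / R * 1 := by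
          gcongr; exact abs_staircase_sub_le _ _
      _ ≤ 1 / 32 := by rw [mul_one, div_le_iff₀ hR0]; linarith
  have hder : ∀ t, deriv (fun t => S (q t)) t = deriv S (q t) * (deriv (staircase c) (t / ε) / R) :=
    fun t => (((hS.differentiable (by norm_num) _).hasDerivAt).comp t (hqd t)).deriv
  refine ⟨fun t => S (q t), hS.comp hq, fun t => ⟨S.nonneg, S.le_one⟩, fun t ht => ?_, fun t ht => ?_,
    fun t => ?_, fun t n ht => ?_⟩
  · refine S.one_of_mem_closedBall (mem_closedBall_zero_iff.2 ?_)
    have h1 : |(t - a) / R| ≤ 1 / 2 := by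
      rw [abs_div, abs_of_pos hR0, div_le_iff₀ hR0]; linarith
    have := abs_sub_abs_le_abs_sub (q t) ((t - a) / R)
    have := hqt t
    change |q t| ≤ 9 / 16
    linarith
  · refine S.zero_of_le_dist ?_
    have h1 : 3 / 4 ≤ |(t - a) / R| := by
      rw [abs_div, abs_of_pos hR0, le_div_iff₀ hR0]; linarith
    have := abs_sub_abs_le_abs_sub ((t - a) / R) (q t)
    have := hqt t
    rw [abs_sub_comm] at this
    rw [dist_zero_right]
    change 5 / 8 ≤ |q t|
    linarith
  · rw [hder, abs_mul, abs_div, abs_of_pos hR0, mul_div_assoc]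
    gcongr
    · exact hK₁ _
    · exact hK₂ _
  · have h : |t / ε - n| < 1 / 2 - c := by
      have : t / ε - n = (t - ε * n) / ε := by field_simp
      rw [this, abs_div, abs_of_pos hε, div_lt_iff₀ hε]; linarith
    rw [hder, deriv_staircase_eq_zero hc hc2 h, zero_div, mul_zero]

/-! ### Product cutoffs on cubes, constant on each inclusion. -/

theorem hasFDerivAt_prod_coord {d : ℕ} {θ : Fin d → ℝ → ℝ} (hθ : ∀ i, ContDiff ℝ (⊤ : ℕ∞) (θ i))
    (x : Vec d) :
    HasFDerivAt (fun y : Vec d => ∏ i, θ i (y i))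
      (∑ i, (∏ j ∈ Finset.univ.erase i, θ j (x j)) •
        (deriv (θ i) (x i) • (EuclideanSpace.proj i : Vec d →L[ℝ] ℝ))) x := by
  refine HasFDerivAt.finsetProd fun i _ => ?_
  have h1 : HasDerivAt (θ i) (deriv (θ i) (x i)) (x i) :=
    ((hθ i).differentiable (by norm_num) _).hasDerivAt
  exact h1.comp_hasFDerivAt x (EuclideanSpace.proj i : Vec d →L[ℝ] ℝ).hasFDerivAt

theorem pderiv_prod_coord {d : ℕ} {θ : Fin d → ℝ → ℝ} (hθ : ∀ i, ContDiff ℝ (⊤ : ℕ∞) (θ i))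
    (i : Fin d) (x : Vec d) :
    pderiv i (fun y : Vec d => ∏ j, θ j (y j)) x =
      (∏ j ∈ Finset.univ.erase i, θ j (x j)) * deriv (θ i) (x i) := by
  rw [pderiv, (hasFDerivAt_prod_coord hθ x).fderiv]
  simp

theorem isOpen_cube {d : ℕ} (x₀ : Vec d) (R : ℝ) : IsOpen (cube x₀ R) := by
  rw [cube, ofPred_forall]
  exact isOpen_iInter_of_finite fun i => isOpen_lt (by fun_prop) continuous_const

theorem isBounded_cube {d : ℕ} (x₀ : Vec d) (R : ℝ) : Bornology.IsBounded (cube x₀ R) := by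
  refine isBounded_iff_forall_norm_le.2 ⟨‖x₀‖ + ∑ _i : Fin d, R, fun x hx => ?_⟩
  have h1 : ‖x - x₀‖ ≤ ∑ i, ‖(x - x₀) i‖ := by
    rw [EuclideanSpace.norm_eq]
    exact Real.sqrt_le_iff.2
      ⟨by positivity, Finset.sum_sq_le_sq_sum_of_nonneg fun i _ => norm_nonneg _⟩
  have h2 : ∑ i, ‖(x - x₀) i‖ ≤ ∑ _i : Fin d, R := Finset.sum_le_sum fun i _ => (hx i).le
  have := norm_le_norm_add_norm_sub' x x₀
  linarith

/-- From `y`, moving by `1/2 - |y i|` outwards along the `i`-th axis leaves the open cell, so the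
segment meets its boundary; hence `1/2 - |y i|` is at least the distance from `y` to the boundary.
-/
theorem InclusionAssumptions.exists_margin {d : ℕ} {ω : Set (Vec d)} (hω : InclusionAssumptions ω) :
    ∃ c : ℝ, 0 < c ∧ c < 1 / 2 ∧ ∀ y ∈ ω, ∀ i, |y i| < 1 / 2 - c := by
  obtain ⟨c, hc0, hc⟩ := ENNReal.lt_iff_exists_nnreal_btwn.1 hω.dist_pos
  have hc0 : (0 : ℝ) < c := by exact_mod_cast hc0
  refine ⟨min c (1 / 4), by positivity, (min_le_right _ _).trans_lt (by norm_num), fun y hy i => ?_⟩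
  have hyi : |y i| < 1 / 2 := by simpa [unitCell, cube] using hω.subset_cell hy i
  obtain ⟨s, hs, hsy⟩ : ∃ s : ℝ, |s| = 1 / 2 - |y i| ∧ 1 / 2 ≤ |y i + s| := by
    rcases le_or_gt 0 (y i) with h | h
    · refine ⟨1 / 2 - |y i|, abs_of_pos (by linarith), ?_⟩
      rw [abs_of_nonneg h]; norm_num
    · refine ⟨-(1 / 2 - |y i|), by rw [abs_neg, abs_of_pos (by linarith)], ?_⟩
      rw [abs_of_neg h]; norm_num
  set z : Vec d := y + EuclideanSpace.single i s with hz
  have hzY : z ∉ unitCell d := fun h => by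
    have := h i
    simp [hz] at this
    linarith
  obtain ⟨w, hw, hwf⟩ : (segment ℝ y z ∩ frontier (unitCell d)).Nonempty := by
    by_contra hne
    have hopen := isOpen_cube (0 : Vec d) (1 / 2)
    have hmem : ∀ v ∈ segment ℝ y z, v ∉ unitCell d → v ∈ (closure (unitCell d))ᶜ :=
      fun v hv hvY hvc => hne ⟨v, hv, hopen.frontier_eq ▸ ⟨hvc, hvY⟩⟩
    obtain ⟨v, -, hvY, hvc⟩ := (convex_segment y z).isPreconnected _ _ hopen
      isClosed_closure.isOpen_compl (fun v hv => or_iff_not_imp_left.2 (hmem v hv))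
      ⟨y, left_mem_segment ℝ y z, hω.subset_cell hy⟩
      ⟨z, right_mem_segment ℝ y z, hmem z (right_mem_segment ℝ y z) hzY⟩
    exact hvc (subset_closure hvY)
  have hdist : dist y w ≤ 1 / 2 - |y i| := by
    have h1 : dist y z = 1 / 2 - |y i| := by simp [hz, hs, dist_eq_norm]
    have := dist_add_dist_of_mem_segment hw
    linarith [dist_nonneg (x := w) (y := z)]
  have hlt : ENNReal.ofReal c < edist y w := by
    rw [ENNReal.ofReal_coe_nnreal]
    exact hc.trans_le ((iInf₂_le y hy).trans (Metric.infEDist_le_edist_of_mem hwf))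
  rw [edist_dist, ENNReal.ofReal_lt_ofReal_iff_of_nonneg hc0.le] at hlt
  linarith [min_le_left (c : ℝ) (1 / 4)]

/-- The interior cutoffs: smooth, equal to `1` on `Q_{R/2}`, supported in `Q_R`, constant on each
inclusion, with gradient `O(1/R)` uniformly in `ε`. -/
theorem exists_cutoff {d : ℕ} {ω : Set (Vec d)} (hω : InclusionAssumptions ω) :
    ∃ K, 0 ≤ K ∧ ∀ (ε R : ℝ) (x₀ : Vec d), 0 < ε → 32 * ε ≤ R → ∃ η : Vec d → ℝ,
      IsTestFunction (cube x₀ R) η ∧ (∀ x, 0 ≤ η x ∧ η x ≤ 1) ∧ (∀ x ∈ cube x₀ (R / 2), η x = 1) ∧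
      (∀ i x, |pderiv i η x| ≤ K / R) ∧
      ∀ (n : Fin d → ℤ), ∀ x ∈ inclusion ω ε n, ∀ i, pderiv i η x = 0 := by
  obtain ⟨c, hc, hc2, hcω⟩ := hω.exists_margin
  obtain ⟨K, hK0, hK⟩ := exists_cutoff_real hc hc2
  refine ⟨K, hK0, fun ε R x₀ hε hR => ?_⟩
  choose θ hθ hθ01 hθ1 hθ0 hθK hθω using fun i => hK ε R (x₀ i) hε hR
  have hR0 : 0 < R := by linarith
  -- The closed cube of radius `3R/4` keeps the closure of the support inside the open `Q_R`.
  have hts : tsupport (fun x : Vec d => ∏ i, θ i (x i)) ⊆ {x | ∀ i, |x i - x₀ i| ≤ 3 * R / 4} := by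
    refine closure_minimal (fun x hx i => not_lt.1 fun h => hx ?_) ?_
    · exact Finset.prod_eq_zero (Finset.mem_univ i) (hθ0 i _ h)
    · rw [ofPred_forall]
      exact isClosed_iInter fun i => isClosed_le (by fun_prop) continuous_const
  have htsQ : tsupport (fun x : Vec d => ∏ i, θ i (x i)) ⊆ cube x₀ R :=
    fun x hx i => (hts hx i).trans_lt (by linarith)
  refine ⟨fun x => ∏ i, θ i (x i), ⟨?_, ?_, htsQ⟩, fun x => ⟨?_, ?_⟩, fun x hx => ?_, fun i x => ?_,
    fun n x hx i => ?_⟩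
  · exact contDiff_prod fun i _ => (hθ i).comp (EuclideanSpace.proj i : Vec d →L[ℝ] ℝ).contDiff
  · exact Metric.isCompact_of_isClosed_isBounded (isClosed_tsupport _)
      ((isBounded_cube x₀ R).subset htsQ)
  · exact Finset.prod_nonneg fun i _ => (hθ01 i _).1
  · exact Finset.prod_le_one (fun i _ => (hθ01 i _).1) fun i _ => (hθ01 i _).2
  · exact Finset.prod_eq_one fun i _ => hθ1 i _ (hx i)
  · rw [pderiv_prod_coord hθ, abs_mul]
    have : |∏ j ∈ Finset.univ.erase i, θ j (x j)| ≤ 1 := by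
      rw [abs_of_nonneg (Finset.prod_nonneg fun i _ => (hθ01 i _).1)]
      exact Finset.prod_le_one (fun i _ => (hθ01 i _).1) fun i _ => (hθ01 i _).2
    calc _ ≤ 1 * (K / R) := by gcongr; exact hθK i _
      _ = K / R := one_mul _
  · obtain ⟨y, hy, rfl⟩ := hx
    rw [pderiv_prod_coord hθ, hθω i _ (n i), mul_zero]
    have : (ε • (latticePt n + y)) i - ε * n i = ε * y i := by simp [latticePt]
    rw [this, abs_mul, abs_of_pos hε]
    exact mul_lt_mul_of_pos_left (hcω y hy i) hε

/-! ### Null boundaries and the values of the contrast. -/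

/-- The graph of a Lipschitz function in the direction `ν` is a null set: its translates along `ν`
are pairwise disjoint. -/
theorem volume_lipschitzGraph {d : ℕ} {ν : Vec d} (hν : ‖ν‖ = 1) {K : ℝ≥0} {ψ : Vec d → ℝ}
    (hψ : LipschitzWith K ψ) :
    volume {x : Vec d | inner ℝ ν x = ψ (x - inner ℝ ν x • ν)} = 0 := by
  set S : Set (Vec d) := {x | inner ℝ ν x = ψ (x - inner ℝ ν x • ν)} with hS
  have hclosed : IsClosed S := by
    have := hψ.continuous
    exact isClosed_eq (by fun_prop) (by fun_prop)
  have hνν : inner ℝ ν ν = (1 : ℝ) := by rw [real_inner_self_eq_norm_sq, hν, one_pow]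
  let T : ℝ → Set (Vec d) := fun t => (fun x => x + t • ν) ⁻¹' S
  have hT : ∀ t, volume (T t) = volume S := fun t => measure_preimage_add_right _ _ _
  have hmem : ∀ t x, x ∈ T t ↔ inner ℝ ν x + t = ψ (x - inner ℝ ν x • ν) := by
    intro t x
    simp only [T, hS, mem_preimage, mem_ofPred_eq, inner_add_right, inner_smul_right, hνν, mul_one,
      add_smul]
    rw [add_sub_add_right_eq_sub]
  have hdisj : Pairwise (Function.onFun Disjoint T) := by
    intro s t hst
    refine Set.disjoint_left.2 fun x hs ht => hst ?_
    rw [hmem] at hs ht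
    linarith
  -- Only countably many disjoint sets can have positive measure, while the translates are indexed
  -- by `ℝ` and all have the same measure.
  have hcount := Measure.countable_meas_pos_of_disjoint_iUnion (μ := (volume : Measure (Vec d)))
    (fun t => (hclosed.preimage (by fun_prop)).measurableSet : ∀ t, MeasurableSet (T t)) hdisj
  by_contra hne
  refine not_countable_univ (α := ℝ) (hcount.mono fun t _ => ?_)
  exact pos_iff_ne_zero.2 (hT t ▸ hne)

/-- Locally the boundary lies on the graph: points above it belong to the open set `U`, and points
below it have a neighbourhood that misses `U`. -/
theorem IsLipschitzDomain.volume_frontier {d : ℕ} {U : Set (Vec d)} (hU : IsLipschitzDomain U) :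
    volume (frontier U) = 0 := by
  refine measure_null_of_locally_null _ fun x₀ hx₀ => ?_
  obtain ⟨r, hr, ν, hν, K, ψ, hψ, h⟩ := hU.boundary x₀ hx₀
  refine ⟨frontier U ∩ Metric.ball x₀ r, inter_mem self_mem_nhdsWithin
    (mem_nhdsWithin_of_mem_nhds (Metric.ball_mem_nhds _ hr)),
    measure_mono_null ?_ (volume_lipschitzGraph hν hψ)⟩
  rintro x ⟨hxU, hxb⟩
  have hψc := hψ.continuous
  have hnot : x ∉ U := fun hx =>
    hU.isOpen.inter_frontier_eq.subset ⟨hx, hxU⟩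
  refine le_antisymm (not_lt.1 fun hlt => hnot ((h x hxb).2 hlt)) (not_lt.1 fun hlt => ?_)
  have hopen : IsOpen {y : Vec d | inner ℝ ν y < ψ (y - inner ℝ ν y • ν)} :=
    isOpen_lt (by fun_prop) (by fun_prop)
  obtain ⟨y, ⟨hy, hyb⟩, hyU⟩ := mem_closure_iff.1 hxU.1 _ (hopen.inter Metric.isOpen_ball) ⟨hlt, hxb⟩
  exact lt_asymm hy ((h y hyb).1 hyU)

theorem finite_setOf_latticePt_mem {d : ℕ} {S : Set (Vec d)} (hS : Bornology.IsBounded S) :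
    {n : Fin d → ℤ | latticePt n ∈ S}.Finite := by
  obtain ⟨M, hM⟩ := hS.exists_norm_le
  refine (Set.finite_Icc (fun _ => -⌈M⌉) (fun _ => ⌈M⌉ : Fin d → ℤ)).subset fun n hn => ?_
  have h : ∀ i, |(n i : ℝ)| ≤ ⌈M⌉ := fun i =>
    ((PiLp.norm_apply_le (latticePt n) i).trans (hM _ hn)).trans (Int.le_ceil M)
  refine ⟨fun i => ?_, fun i => ?_⟩
  · exact_mod_cast (abs_le.1 (h i)).1
  · exact_mod_cast (abs_le.1 (h i)).2

/-- Finiteness makes closure commute with the union, so the boundary of `D_ε` is covered by the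
boundaries of the single inclusions. -/
theorem finite_indexSet {d : ℕ} {Ω ω : Set (Vec d)} {κ ε : ℝ} (hω : ω.Nonempty)
    (hΩ : Bornology.IsBounded Ω) (hε : 0 < ε) : (indexSet Ω ω κ ε).Finite := by
  obtain ⟨w, hw⟩ := hω
  have hb : Bornology.IsBounded ((fun y : Vec d => ε⁻¹ • y + -w) '' Ω) := by
    obtain ⟨M, hM⟩ := hΩ.exists_norm_le
    refine isBounded_iff_forall_norm_le.2 ⟨‖ε⁻¹‖ * M + ‖w‖, ?_⟩
    rintro _ ⟨y, hy, rfl⟩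
    refine (norm_add_le _ _).trans ?_
    rw [norm_smul, norm_neg]
    gcongr
    exact hM y hy
  refine (finite_setOf_latticePt_mem hb).subset fun n hn => ?_
  refine ⟨ε • (latticePt n + w), hn.1 ⟨w, hw, rfl⟩, ?_⟩
  simp [smul_smul, inv_mul_cancel₀ hε.ne']

theorem isOpen_inclusion {d : ℕ} {ω : Set (Vec d)} (hω : IsOpen ω) {ε : ℝ} (hε : 0 < ε)
    (n : Fin d → ℤ) : IsOpen (inclusion ω ε n) :=
  ((isOpenMap_smul₀ hε.ne').comp (isOpenMap_add_left _)) _ hω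

theorem isOpen_inclusions {d : ℕ} {Ω ω : Set (Vec d)} (hω : IsOpen ω) {κ ε : ℝ} (hε : 0 < ε) :
    IsOpen (inclusions Ω ω κ ε) :=
  isOpen_biUnion fun n _ => isOpen_inclusion hω hε n

theorem volume_frontier_inclusion {d : ℕ} {ω : Set (Vec d)} (hω : volume (frontier ω) = 0) {ε : ℝ}
    (hε : 0 < ε) (n : Fin d → ℤ) : volume (frontier (inclusion ω ε n)) = 0 := by
  let e : Vec d ≃ₜ Vec d := (Homeomorph.addLeft (latticePt n)).trans (Homeomorph.smulOfNeZero ε hε.ne')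
  have he : inclusion ω ε n = e '' ω := rfl
  rw [he, ← e.image_frontier]
  have : e '' frontier ω = ε • ((fun y => latticePt n + y) '' frontier ω) := by
    rw [← image_smul, image_image]; rfl
  rw [this, Measure.addHaar_smul, image_add_left, measure_preimage_add, hω, mul_zero]

theorem frontier_biUnion_subset {X ι : Type*} [TopologicalSpace X] {I : Set ι} (hI : I.Finite)
    (f : ι → Set X) : frontier (⋃ i ∈ I, f i) ⊆ ⋃ i ∈ I, frontier (f i) := by
  intro x hx
  rw [frontier, hI.closure_biUnion] at hx
  obtain ⟨i, hi, hxi⟩ := mem_iUnion₂.1 hx.1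
  exact mem_iUnion₂.2 ⟨i, hi, hxi, fun h => hx.2 (interior_mono (subset_biUnion_of_mem hi) h)⟩

theorem volume_frontier_inclusions {d : ℕ} {Ω ω : Set (Vec d)} (hω : IsLipschitzDomain ω)
    (hΩ : Bornology.IsBounded Ω) {κ ε : ℝ} (hε : 0 < ε) :
    volume (frontier (inclusions Ω ω κ ε)) = 0 := by
  have hfin : (indexSet Ω ω κ ε).Finite := finite_indexSet hω.isConnected.nonempty hΩ hε
  refine measure_mono_null (frontier_biUnion_subset hfin _) ?_
  exact (measure_biUnion_null_iff hfin.countable).2 fun n _ =>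
    volume_frontier_inclusion hω.volume_frontier hε n

theorem contrast_of_mem {d : ℕ} {Ω ω : Set (Vec d)} {κ ε δ : ℝ} {x : Vec d}
    (hx : x ∈ inclusions Ω ω κ ε) : contrast Ω ω κ ε δ x = δ := by
  simp [contrast, hx, subset_closure hx]

theorem contrast_of_notMem_closure {d : ℕ} {Ω ω : Set (Vec d)} {κ ε δ : ℝ} {x : Vec d}
    (hxΩ : x ∈ Ω) (hx : x ∉ closure (inclusions Ω ω κ ε)) : contrast Ω ω κ ε δ x = 1 := by
  have h : x ∉ inclusions Ω ω κ ε := fun h => hx (subset_closure h)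
  simp [contrast, hx, hxΩ, h]

/-- Almost everywhere in `Ω` the contrast equals `δ` inside and `1` outside the inclusions. -/
theorem ae_contrast {d : ℕ} {Ω ω : Set (Vec d)} (hω : IsLipschitzDomain ω)
    (hΩ : Bornology.IsBounded Ω) {κ ε : ℝ} (hε : 0 < ε) (δ : ℝ) :
    ∀ᵐ x, x ∈ Ω → (x ∈ inclusions Ω ω κ ε ∧ contrast Ω ω κ ε δ x = δ) ∨
      contrast Ω ω κ ε δ x = 1 := by
  have h : ∀ᵐ x, x ∉ frontier (inclusions Ω ω κ ε) :=
    measure_eq_zero_iff_ae_notMem.1 (volume_frontier_inclusions hω hΩ hε)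
  filter_upwards [h] with x hx hxΩ
  by_cases hxD : x ∈ inclusions Ω ω κ ε
  · exact .inl ⟨hxD, contrast_of_mem hxD⟩
  · refine .inr (contrast_of_notMem_closure hxΩ fun hc => hx ⟨hc, fun hi => hxD (interior_subset hi)⟩)

theorem measurable_contrast {d : ℕ} {Ω ω : Set (Vec d)} (hω : IsOpen ω) (hΩ : IsOpen Ω)
    {κ ε : ℝ} (hε : 0 < ε) (δ : ℝ) : Measurable (contrast Ω ω κ ε δ) :=
  ((measurable_const.indicator (isOpen_inclusions hω hε).measurableSet).const_mul δ).add
    (measurable_const.indicator (hΩ.measurableSet.diff isClosed_closure.measurableSet))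

theorem abs_contrast_le {d : ℕ} (Ω ω : Set (Vec d)) (κ ε : ℝ) {δ : ℝ} (hδ : 1 < δ) (x : Vec d) :
    |contrast Ω ω κ ε δ x| ≤ δ + 1 := by
  unfold contrast indicator
  rw [abs_of_nonneg (by positivity)]
  split_ifs <;> linarith

/-! ### Testing the weak formulation with `ζ u`. -/

theorem memLp_coord {d : ℕ} {ι : Type*} [Fintype ι] {U : Set (Vec d)} {f : Vec d → EuclideanSpace ℝ ι}
    (hf : MemLp f 2 (volume.restrict U)) (p : ι) : MemLp (fun x => f x p) 2 (volume.restrict U) :=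
  (EuclideanSpace.proj p : EuclideanSpace ℝ ι →L[ℝ] ℝ).comp_memLp' hf

theorem IsTestFunction.continuous_pderiv {d : ℕ} {F : Type*} [NormedAddCommGroup F] [NormedSpace ℝ F]
    {U : Set (Vec d)} {φ : Vec d → F} (hφ : IsTestFunction U φ) (i : Fin d) :
    Continuous (pderiv i φ) :=
  (hφ.smooth.continuous_fderiv (by norm_num)).clm_apply continuous_const

theorem IsTestFunction.hasCompactSupport_pderiv {d : ℕ} {F : Type*} [NormedAddCommGroup F]
    [NormedSpace ℝ F] {U : Set (Vec d)} {φ : Vec d → F} (hφ : IsTestFunction U φ) (i : Fin d) :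
    HasCompactSupport (pderiv i φ) :=
  hφ.hasCompactSupport.fderiv_apply ℝ _

theorem pderiv_mul {d : ℕ} {φ ψ : Vec d → ℝ} {x : Vec d} (hφ : DifferentiableAt ℝ φ x)
    (hψ : DifferentiableAt ℝ ψ x) (i : Fin d) :
    pderiv i (fun y => φ y * ψ y) x = φ x * pderiv i ψ x + ψ x * pderiv i φ x := by
  simp only [pderiv, fderiv_fun_mul hφ hψ]
  simp

theorem pderiv_comp_const_sub {d : ℕ} {φ : Vec d → ℝ} (hφ : Differentiable ℝ φ) (i : Fin d)
    (x y : Vec d) : pderiv i (fun z => φ (x - z)) y = -pderiv i φ (x - y) := by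
  have h := (hφ (x - y)).hasFDerivAt.comp y ((hasFDerivAt_id y).const_sub x)
  have h' : fderiv ℝ (fun z => φ (x - z)) y = _ := h.fderiv
  simp [pderiv, h']

/-- The weak product rule, mollified: `∂ᵢ (ρ ⋆ ζ u^α) = ρ ⋆ (ζ ∂ᵢ u^α + ∂ᵢ ζ u^α)`. -/
theorem IsH1With.pderiv_convolution {d m : ℕ} {U : Set (Vec d)} (hU : MeasurableSet U)
    {u : Vec d → Vec m} {Du : Vec d → Grad d m} (hu : IsH1With U u Du) {ζ : Vec d → ℝ}
    (hζ : IsTestFunction U ζ) {ρ : Vec d → ℝ} (hρ : ContDiff ℝ (⊤ : ℕ∞) ρ)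
    (hρc : HasCompactSupport ρ) (hv : ∀ α, LocallyIntegrable (U.indicator fun y => ζ y * u y α) volume)
    (i : Fin d) (α : Fin m) (x : Vec d) :
    pderiv i (ρ ⋆[ContinuousLinearMap.lsmul ℝ ℝ, volume] U.indicator fun y => ζ y * u y α) x =
      (ρ ⋆[ContinuousLinearMap.lsmul ℝ ℝ, volume]
        U.indicator fun y => ζ y * Du y (i, α) + pderiv i ζ y * u y α) x := by
  have hρd : Differentiable ℝ ρ := hρ.differentiable (by norm_num)
  have hζd : Differentiable ℝ ζ := hζ.smooth.differentiable (by norm_num)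
  have h1 := hρc.hasFDerivAt_convolution_left (ContinuousLinearMap.lsmul ℝ ℝ) (hρ.of_le (by norm_num))
    (hv α) x
  have hex := (hρc.fderiv (𝕜 := ℝ)).convolutionExists_left
    ((ContinuousLinearMap.lsmul ℝ ℝ : ℝ →L[ℝ] ℝ →L[ℝ] ℝ).precompL (Vec d))
    (hρ.continuous_fderiv (by norm_num)) (hv α) x
  have hcs : HasCompactSupport fun y => ρ (x - y) :=
    hρc.comp_homeomorph (Homeomorph.subLeft x)
  have hcont : Continuous fun y => ρ (x - y) := by
    have := hρ.continuous; fun_prop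
  -- The weak derivative is tested with this product: `ζ` confines the support to `U`, and the
  -- product rule yields both terms of the claim.
  have hψ : IsTestFunction U fun y => ρ (x - y) * ζ y :=
    ⟨(hρ.comp (contDiff_const.sub contDiff_id)).mul hζ.smooth, hζ.hasCompactSupport.mul_left,
      (tsupport_mul_subset_right).trans hζ.tsupport_subset⟩
  have hint := hu.integral_eq _ hψ i α
  have hψd : ∀ y, pderiv i (fun y => ρ (x - y) * ζ y) y =
      ρ (x - y) * pderiv i ζ y - pderiv i ρ (x - y) * ζ y := fun y => by
    have hd : DifferentiableAt ℝ (fun y => ρ (x - y)) y := by fun_prop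
    rw [pderiv_mul hd (hζd y), pderiv_comp_const_sub hρd]; ring
  have hL2 : ∀ {g : Vec d → ℝ}, Continuous g → HasCompactSupport g →
      MemLp g 2 (volume.restrict U) := fun hg hgc =>
    (hg.memLp_of_hasCompactSupport hgc).restrict U
  have hua := memLp_coord hu.memLp α
  have hDu := memLp_coord hu.memLp_grad (i, α)
  have hi1 : IntegrableOn (fun y => u y α * (ρ (x - y) * pderiv i ζ y)) U volume :=
    hua.integrable_mul (hL2 (hcont.mul (hζ.continuous_pderiv i)) hcs.mul_right)
  have hi2 : IntegrableOn (fun y => u y α * (pderiv i ρ (x - y) * ζ y)) U volume := by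
    refine hua.integrable_mul (hL2 (Continuous.mul ?_ hζ.smooth.continuous)
      hζ.hasCompactSupport.mul_left)
    exact ((hρ.continuous_fderiv (by norm_num)).clm_apply continuous_const).comp
      (continuous_const.sub continuous_id)
  have hi3 : IntegrableOn (fun y => Du y (i, α) * (ρ (x - y) * ζ y)) U volume :=
    hDu.integrable_mul (hL2 (hcont.mul hζ.smooth.continuous) hcs.mul_right)
  have key : ∫ y in U, u y α * (pderiv i ρ (x - y) * ζ y) =
      ∫ y in U, ρ (x - y) * (ζ y * Du y (i, α) + pderiv i ζ y * u y α) := by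
    have e1 : ∫ y in U, u y α * (ρ (x - y) * pderiv i ζ y - pderiv i ρ (x - y) * ζ y) =
        (∫ y in U, u y α * (ρ (x - y) * pderiv i ζ y)) -
          ∫ y in U, u y α * (pderiv i ρ (x - y) * ζ y) := by
      rw [← integral_sub hi1 hi2]; simp only [mul_sub]
    have e2 : ∫ y in U, ρ (x - y) * (ζ y * Du y (i, α) + pderiv i ζ y * u y α) =
        (∫ y in U, Du y (i, α) * (ρ (x - y) * ζ y)) +
          ∫ y in U, u y α * (ρ (x - y) * pderiv i ζ y) := by
      rw [← integral_add hi3 hi1]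
      exact integral_congr_ae (.of_forall fun y => by simp only; ring)
    simp only [hψd] at hint
    rw [e1] at hint
    rw [e2]; linarith
  have hL : pderiv i (ρ ⋆[ContinuousLinearMap.lsmul ℝ ℝ, volume] U.indicator fun y => ζ y * u y α) x =
      ∫ y in U, u y α * (pderiv i ρ (x - y) * ζ y) := by
    rw [pderiv, h1.fderiv, convolution_def, ContinuousLinearMap.integral_apply hex,
      ← integral_sub_left_eq_self _ volume x, ← integral_indicator hU]
    refine integral_congr_ae (.of_forall fun y => ?_)
    by_cases hy : y ∈ U <;> simp [hy, pderiv]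
    ring
  rw [hL, key, convolution_eq_swap, ← integral_indicator hU]
  refine integral_congr_ae (.of_forall fun y => ?_)
  by_cases hy : y ∈ U <;> simp [hy]

theorem tendsto_sum_setIntegral_mul_convolution {d : ℕ} {ι : Type*} [Fintype ι] {U : Set (Vec d)}
    (hU : MeasurableSet U) {F G : ι → Vec d → ℝ} (hF : ∀ p, MemLp (F p) 2 (volume.restrict U))
    (hG : ∀ p, MemLp (G p) 2 (volume.restrict U)) {φ : ℕ → ContDiffBump (0 : Vec d)}
    (hφ : Tendsto (fun k => (φ k).rOut) atTop (𝓝 0)) :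
    Tendsto (fun k => ∑ p, ∫ x in U, F p x *
      ((φ k).normed volume ⋆[ContinuousLinearMap.lsmul ℝ ℝ, volume] U.indicator (G p)) x) atTop
      (𝓝 (∑ p, ∫ x in U, F p x * G p x)) := by
  refine tendsto_finsetSum _ fun p _ => ?_
  have h := tendsto_integral_mul_convolution ((memLp_indicator_iff_restrict hU).2 (hF p))
    ((memLp_indicator_iff_restrict hU).2 (hG p)) hφ
  have e : ∀ g : Vec d → ℝ, ∫ x in U, F p x * g x = ∫ x, U.indicator (F p) x * g x := fun g => by
    rw [← integral_indicator hU]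
    exact integral_congr_ae (.of_forall fun x => by by_cases hx : x ∈ U <;> simp [hx])
  have e' : ∫ x in U, F p x * G p x = ∫ x, U.indicator (F p) x * U.indicator (G p) x := by
    rw [e]
    exact integral_congr_ae (.of_forall fun x => by by_cases hx : x ∈ U <;> simp [hx])
  rw [e']
  simpa only [e] using h

/-- A weak formulation tested against smooth fields may be tested against `ζ u`, where `ζ` is a
smooth cutoff and `u ∈ H¹`. -/
theorem IsH1With.integral_test_mul {d m : ℕ} {U : Set (Vec d)} (hU : IsOpen U)
    {u : Vec d → Vec m} {Du : Vec d → Grad d m} (hu : IsH1With U u Du)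
    {F : Fin d × Fin m → Vec d → ℝ} (hF : ∀ p, MemLp (F p) 2 (volume.restrict U))
    {f : Vec d → Vec m} (hf : MemLp f 2 (volume.restrict U))
    (hweak : ∀ φ : Vec d → Vec m, IsTestFunction U φ →
      ∫ x in U, ∑ p, F p x * classicalGrad φ x p = ∫ x in U, inner ℝ (f x) (φ x))
    {ζ : Vec d → ℝ} (hζ : IsTestFunction U ζ) :
    ∑ p, ∫ x in U, F p x * (ζ x * Du x p + pderiv p.1 ζ x * u x p.2) =
      ∑ α, ∫ x in U, f x α * (ζ x * u x α) := by
  have hUm := hU.measurableSet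
  have hbdd : ∀ {g v : Vec d → ℝ}, Continuous g → HasCompactSupport g →
      MemLp v 2 (volume.restrict U) → MemLp (fun x => g x * v x) 2 (volume.restrict U) :=
    fun {g v} hg hgc hv => hv.mul (hg.memLp_of_hasCompactSupport hgc (p := ∞))
  have hv : ∀ α, MemLp (fun y => ζ y * u y α) 2 (volume.restrict U) := fun α =>
    hbdd hζ.smooth.continuous hζ.hasCompactSupport (memLp_coord hu.memLp α)
  have hG : ∀ p : Fin d × Fin m, MemLp (fun y => ζ y * Du y p + pderiv p.1 ζ y * u y p.2) 2
      (volume.restrict U) := fun p =>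
    (hbdd hζ.smooth.continuous hζ.hasCompactSupport (memLp_coord hu.memLp_grad p)).add
      (hbdd (hζ.continuous_pderiv p.1) (hζ.hasCompactSupport_pderiv p.1) (memLp_coord hu.memLp p.2))
  have hloc : ∀ α, LocallyIntegrable (U.indicator fun y => ζ y * u y α) volume := fun α =>
    ((memLp_indicator_iff_restrict hUm).2 (hv α)).locallyIntegrable (by norm_num)
  let φ : ℕ → ContDiffBump (0 : Vec d) := fun k =>
    ⟨1 / (2 * (k + 1)), 1 / (k + 1), by positivity, by
      rw [div_lt_div_iff₀ (by positivity) (by positivity)]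
      have : (0 : ℝ) ≤ k := Nat.cast_nonneg k
      linarith⟩
  have hφ : Tendsto (fun k => (φ k).rOut) atTop (𝓝 0) := tendsto_one_div_add_atTop_nhds_zero_nat
  have hρ : ∀ k, ContDiff ℝ (⊤ : ℕ∞) ((φ k).normed volume) := fun k => (φ k).contDiff_normed
  let w : ℕ → Vec d → Vec m := fun k x => WithLp.toLp 2 fun α =>
    ((φ k).normed volume ⋆[ContinuousLinearMap.lsmul ℝ ℝ, volume] U.indicator fun y => ζ y * u y α) x
  have hwsmooth : ∀ k, ContDiff ℝ (⊤ : ℕ∞) (w k) := fun k => contDiff_euclidean.2 fun α =>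
    (φ k).hasCompactSupport_normed.contDiff_convolution_left _ (hρ k) (hloc α)
  have hwgrad : ∀ k x (p : Fin d × Fin m), classicalGrad (w k) x p =
      ((φ k).normed volume ⋆[ContinuousLinearMap.lsmul ℝ ℝ, volume]
        U.indicator fun y => ζ y * Du y p + pderiv p.1 ζ y * u y p.2) x := by
    rintro k x ⟨i, α⟩
    rw [← hu.pderiv_convolution hUm hζ (hρ k) (φ k).hasCompactSupport_normed hloc i α x]
    have h := ((EuclideanSpace.proj α : Vec m →L[ℝ] ℝ).hasFDerivAt).comp x
      ((hwsmooth k).differentiable (by norm_num) x).hasFDerivAt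
    exact (congrArg (fun T : Vec d →L[ℝ] ℝ => T (EuclideanSpace.single i 1)) h.fderiv).symm
  -- A mollifier of radius less than `r` enlarges the support of `ζ` without leaving `U`, so the
  -- mollified fields are eventually admissible.
  obtain ⟨r, hr, hrU⟩ := hζ.hasCompactSupport.isCompact.exists_cthickening_subset_open hU
    hζ.tsupport_subset
  have hwtest : ∀ᶠ k in atTop, IsTestFunction U (w k) := by
    filter_upwards [hφ.eventually (gt_mem_nhds hr)] with k hk
    have hsub : tsupport (w k) ⊆ Metric.cthickening r (tsupport ζ) := by
      refine closure_minimal (fun x hx => ?_) Metric.isClosed_cthickening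
      obtain ⟨α, hα⟩ : ∃ α, w k x α ≠ 0 := by
        by_contra! h
        exact hx (PiLp.ext h)
      obtain ⟨a, ha, b, hb, rfl⟩ := support_convolution_subset _ hα
      rw [(φ k).support_normed_eq] at ha
      have hbζ : b ∈ tsupport ζ := by
        refine subset_tsupport _ fun h0 => hb ?_
        simp [indicator, h0]
      refine Metric.mem_cthickening_of_dist_le _ b _ _ hbζ ?_
      rw [dist_eq_norm, add_sub_cancel_right]
      exact ((mem_ball_zero_iff.1 ha).trans hk).le
    refine ⟨hwsmooth k, ?_, hsub.trans hrU⟩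
    exact (hζ.hasCompactSupport.isCompact.cthickening).of_isClosed_subset (isClosed_tsupport _) hsub
  have hlimL := tendsto_sum_setIntegral_mul_convolution hUm hF hG hφ
  have hlimR := tendsto_sum_setIntegral_mul_convolution hUm (fun α => memLp_coord hf α) hv hφ
  -- Both sides converge as the mollifier shrinks, and they agree for all large `k`.
  refine tendsto_nhds_unique (hlimL.congr' ?_) hlimR
  filter_upwards [hwtest] with k hk
  have hcoord : ∀ {ι : Type} [Fintype ι] {g : Vec d → EuclideanSpace ℝ ι} (p : ι), Continuous g →
      HasCompactSupport g → MemLp (fun x => g x p) 2 (volume.restrict U) := fun p hg hgc =>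
    memLp_coord ((hg.memLp_of_hasCompactSupport hgc).restrict U) p
  have hgc : ∀ p : Fin d × Fin m, MemLp (fun x => classicalGrad (w k) x p) 2 (volume.restrict U) :=
    fun p => hcoord p.2 (hk.continuous_pderiv p.1) (hk.hasCompactSupport_pderiv p.1)
  have hfc : ∀ α, MemLp (fun x => w k x α) 2 (volume.restrict U) :=
    fun α => hcoord α hk.smooth.continuous hk.hasCompactSupport
  have h := hweak _ hk
  have hl : ∫ x in U, ∑ p, F p x * classicalGrad (w k) x p =
      ∑ p, ∫ x in U, F p x * classicalGrad (w k) x p :=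
    integral_finsetSum _ fun p _ => (hF p).integrable_mul (hgc p)
  have hr : ∫ x in U, inner ℝ (f x) (w k x) = ∑ α, ∫ x in U, f x α * w k x α := by
    refine Eq.trans ?_ (integral_finsetSum _ fun α _ => (memLp_coord hf α).integrable_mul (hfc α))
    refine integral_congr_ae (.of_forall fun x => ?_)
    simp [PiLp.inner_apply, mul_comm]
  rw [hl, hr] at h
  simpa only [hwgrad] using h

/-! ### The quadratic form of the coefficients and the flux. -/

theorem coeffForm_eq_sum {d m : ℕ} (A : Coeff d m) (y : Vec d) (ξ ζ : Grad d m) :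
    coeffForm A y ξ ζ = ∑ p, (∑ q, A y p q * ξ q) * ζ p := by
  simp only [coeffForm, Fintype.sum_prod_type, Finset.sum_mul]
  exact Finset.sum_congr rfl fun i _ => Finset.sum_comm

theorem CoeffAssumptions.coeffForm_comm {d m : ℕ} {μ lam τ : ℝ} {A : Coeff d m}
    (hA : CoeffAssumptions μ lam τ A) (y : Vec d) (ξ ζ : Grad d m) :
    coeffForm A y ξ ζ = coeffForm A y ζ ξ := by
  simp only [coeffForm_eq_sum, Finset.sum_mul]
  rw [Finset.sum_comm]
  refine Finset.sum_congr rfl fun q _ => Finset.sum_congr rfl fun p _ => ?_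
  rw [show A y p q = A y q p from hA.symmetry y p.1 q.1 p.2 q.2]; ring

theorem CoeffAssumptions.coeffForm_add_smul {d m : ℕ} {μ lam τ : ℝ} {A : Coeff d m}
    (hA : CoeffAssumptions μ lam τ A) (y : Vec d) (ξ ζ : Grad d m) (t : ℝ) :
    coeffForm A y (ξ + t • ζ) (ξ + t • ζ) =
      coeffForm A y ξ ξ + 2 * t * coeffForm A y ξ ζ + t ^ 2 * coeffForm A y ζ ζ := by
  have h : coeffForm A y (ξ + t • ζ) (ξ + t • ζ) = coeffForm A y ξ ξ + t * coeffForm A y ξ ζ +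
      t * coeffForm A y ζ ξ + t ^ 2 * coeffForm A y ζ ζ := by
    simp only [coeffForm, Finset.mul_sum, ← Finset.sum_add_distrib, PiLp.add_apply, PiLp.smul_apply,
      smul_eq_mul]
    refine Finset.sum_congr rfl fun _ _ => Finset.sum_congr rfl fun _ _ =>
      Finset.sum_congr rfl fun _ _ => Finset.sum_congr rfl fun _ _ => ?_
    ring
  rw [h, hA.coeffForm_comm y ζ ξ]; ring

theorem CoeffAssumptions.coeffForm_nonneg {d m : ℕ} {μ lam τ : ℝ} {A : Coeff d m}
    (hμ : 0 < μ) (hA : CoeffAssumptions μ lam τ A) (y : Vec d) (ξ : Grad d m) :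
    0 ≤ coeffForm A y ξ ξ :=
  le_trans (by positivity) (hA.elliptic y ξ).1

/-- Young's inequality for the quadratic form of the coefficients. -/
theorem CoeffAssumptions.young {d m : ℕ} {μ lam τ : ℝ} {A : Coeff d m} (hμ : 0 < μ)
    (hA : CoeffAssumptions μ lam τ A) (y : Vec d) (ξ ζ : Grad d m) :
    1 / 2 * coeffForm A y ξ ξ - 2 * coeffForm A y ζ ζ ≤
      coeffForm A y ξ ξ + 2 * coeffForm A y ξ ζ := by
  -- Half of the form at `ξ + 2ζ` is exactly the difference of the two sides.
  have h := hA.coeffForm_nonneg hμ y (ξ + (2 : ℝ) • ζ)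
  rw [hA.coeffForm_add_smul] at h
  linarith

theorem CoeffAssumptions.abs_sub_le {d m : ℕ} {μ lam τ : ℝ} {A : Coeff d m}
    (hA : CoeffAssumptions μ lam τ A) (y w : Vec d) (p q : Fin d × Fin m) :
    |A y p q - A w p q| ≤ τ * ‖y - w‖ ^ lam := by
  refine le_trans ?_ (hA.holder y w)
  rw [← Real.sqrt_sq_eq_abs]
  refine Real.sqrt_le_sqrt ?_
  refine le_trans ?_ (Finset.single_le_sum (f := fun p => ∑ q, (A y p q - A w p q) ^ 2)
    (fun p _ => Finset.sum_nonneg fun q _ => sq_nonneg _) (Finset.mem_univ p))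
  exact Finset.single_le_sum (f := fun q => (A y p q - A w p q) ^ 2) (fun q _ => sq_nonneg _)
    (Finset.mem_univ q)

theorem CoeffAssumptions.continuous {d m : ℕ} {μ lam τ : ℝ} {A : Coeff d m} (hlam : 0 < lam)
    (hA : CoeffAssumptions μ lam τ A) (p q : Fin d × Fin m) : Continuous fun y => A y p q := by
  refine continuous_iff_continuousAt.2 fun w => tendsto_iff_dist_tendsto_zero.2 ?_
  refine squeeze_zero (fun _ => dist_nonneg) (fun y => hA.abs_sub_le y w p q) ?_
  have h : Continuous fun y : Vec d => τ * ‖y - w‖ ^ lam :=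
    continuous_const.mul ((continuous_id.sub continuous_const).norm.rpow_const fun _ => .inr hlam.le)
  simpa [Real.zero_rpow hlam.ne'] using h.tendsto w

theorem exists_bound_of_continuous_of_isBounded {d : ℕ} {U : Set (Vec d)} (hU : Bornology.IsBounded U)
    {g : Vec d → ℝ} (hg : Continuous g) : ∃ C, ∀ x ∈ U, ‖g x‖ ≤ C := by
  obtain ⟨C, hC⟩ := hU.isCompact_closure.exists_bound_of_continuousOn hg.continuousOn
  exact ⟨C, fun x hx => hC x (subset_closure hx)⟩

/-- The flux `Λ_{ε,δ} A(x/ε) Du` of a square integrable gradient is square integrable. -/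
theorem memLp_flux {d m : ℕ} {μ lam τ κ ε δ : ℝ} {A : Coeff d m} (hlam : 0 < lam)
    (hA : CoeffAssumptions μ lam τ A) {Ω ω : Set (Vec d)} (hω : IsOpen ω) (hΩ : IsOpen Ω)
    (hε : 0 < ε) (hδ : 1 < δ) {U : Set (Vec d)} (hU : MeasurableSet U) (hUb : Bornology.IsBounded U)
    {Du : Vec d → Grad d m} (hDu : MemLp Du 2 (volume.restrict U)) (p : Fin d × Fin m) :
    MemLp (fun x => contrast Ω ω κ ε δ x * ∑ q, A (ε⁻¹ • x) p q * Du x q) 2 (volume.restrict U) := by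
  have hΛ : MemLp (contrast Ω ω κ ε δ) ∞ (volume.restrict U) :=
    memLp_top_of_bound (measurable_contrast hω hΩ hε δ).aestronglyMeasurable (δ + 1)
      (.of_forall fun x => abs_contrast_le Ω ω κ ε hδ x)
  have hsum : MemLp (fun x => ∑ q, A (ε⁻¹ • x) p q * Du x q) 2 (volume.restrict U) := by
    refine memLp_finsetSum _ fun q _ => ?_
    have hc : Continuous fun x : Vec d => A (ε⁻¹ • x) p q :=
      (hA.continuous hlam p q).comp (continuous_const_smul _)
    obtain ⟨C, hC⟩ := exists_bound_of_continuous_of_isBounded hUb hc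
    exact (memLp_coord hDu q).mul (memLp_top_of_bound hc.aestronglyMeasurable C
      ((ae_restrict_iff' hU).2 (.of_forall hC)))
  exact hsum.mul hΛ

/-! ### The Caccioppoli inequality. -/

/-- Caccioppoli's inequality for high contrast, with constant uniform in `ε` and `δ > 1`, from a
cutoff function whose gradient vanishes on the inclusions. -/
theorem caccioppoli_of_cutoff {d m : ℕ} {μ lam τ κ ε δ R K : ℝ} (hμ : 0 < μ) (hlam : 0 < lam)
    {ω Ω : Set (Vec d)} (hω : IsLipschitzDomain ω) (hΩ : IsOpen Ω) (hΩb : Bornology.IsBounded Ω)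
    {A : Coeff d m} (hA : CoeffAssumptions μ lam τ A) (hε : 0 < ε) (hδ : 1 < δ) (hR : 0 < R)
    {x₀ : Vec d} (hQ : cube x₀ R ⊆ Ω)
    {u : Vec d → Vec m} {Du : Vec d → Grad d m} {f : Vec d → Vec m}
    (hf : MemLp f 2 (volume.restrict (cube x₀ R)))
    (hu : IsWeakSolution Ω ω κ ε δ A (cube x₀ R) u Du f)
    {η : Vec d → ℝ} (hη : IsTestFunction (cube x₀ R) η) (hη01 : ∀ x, 0 ≤ η x ∧ η x ≤ 1)
    (hη1 : ∀ x ∈ cube x₀ (R / 2), η x = 1) (hηK : ∀ i x, |pderiv i η x| ≤ K / R)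
    (hηω : ∀ n : Fin d → ℤ, ∀ x ∈ inclusion ω ε n, ∀ i, pderiv i η x = 0) :
    μ / 2 * (∫ x in cube x₀ (R / 2), ‖Du x‖ ^ 2) ≤
      (2 * μ⁻¹ * (d * K ^ 2) + 1) * (1 / R ^ 2 * ∫ x in cube x₀ R, ‖u x‖ ^ 2) +
        R ^ 2 * ∫ x in cube x₀ R, ‖f x‖ ^ 2 := by
  obtain ⟨hH1, hweak⟩ := hu
  set Q := cube x₀ R
  have hQo : IsOpen Q := isOpen_cube x₀ R
  have hQm : MeasurableSet Q := hQo.measurableSet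
  let F : Fin d × Fin m → Vec d → ℝ := fun p x =>
    contrast Ω ω κ ε δ x * ∑ q, A (ε⁻¹ • x) p q * Du x q
  have hFL : ∀ p, MemLp (F p) 2 (volume.restrict Q) := fun p =>
    memLp_flux hlam hA hω.isOpen hΩ hε hδ hQm (isBounded_cube x₀ R) hH1.memLp_grad p
  have hFsum : ∀ x (ξ : Grad d m), ∑ p, F p x * ξ p =
      contrast Ω ω κ ε δ x * coeffForm A (ε⁻¹ • x) (Du x) ξ := fun x ξ => by
    simp only [F, coeffForm_eq_sum, mul_assoc]
    rw [Finset.mul_sum]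
  have hζ : IsTestFunction Q fun x => η x * η x :=
    ⟨hη.smooth.mul hη.smooth, hη.hasCompactSupport.mul_left,
      tsupport_mul_subset_right.trans hη.tsupport_subset⟩
  have hηd : Differentiable ℝ η := hη.smooth.differentiable (by norm_num)
  have hmain := hH1.integral_test_mul hQo hFL hf (fun φ hφ => by
    simp only [hFsum]; exact hweak φ hφ) hζ
  let W : Vec d → Grad d m := fun x => WithLp.toLp 2 fun p => pderiv p.1 η x * u x p.2
  -- With `W = ∇η ⊗ u`, the gradient of `η² u` is `η (η Du + 2 W)`. The outer `η` moves onto the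
  -- flux, leaving the form at `η Du` plus twice its pairing with `W`.
  have hG : ∀ x (p : Fin d × Fin m), η x * η x * Du x p +
      pderiv p.1 (fun y => η y * η y) x * u x p.2 = η x * ((η x • Du x + (2 : ℝ) • W x) p) := by
    intro x p
    rw [pderiv_mul (hηd x) (hηd x)]
    simp only [W, PiLp.add_apply, PiLp.smul_apply, smul_eq_mul]; ring
  have hbdd : ∀ {g v : Vec d → ℝ}, Continuous g → HasCompactSupport g →
      MemLp v 2 (volume.restrict Q) → MemLp (fun x => g x * v x) 2 (volume.restrict Q) :=
    fun {g v} hg hgc hv => hv.mul (hg.memLp_of_hasCompactSupport hgc (p := ∞))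
  have hiL : ∀ p : Fin d × Fin m, IntegrableOn (fun x => F p x * (η x * η x * Du x p +
      pderiv p.1 (fun y => η y * η y) x * u x p.2)) Q volume := fun p =>
    (hFL p).integrable_mul ((hbdd hζ.smooth.continuous hζ.hasCompactSupport
      (memLp_coord hH1.memLp_grad p)).add (hbdd (hζ.continuous_pderiv p.1)
        (hζ.hasCompactSupport_pderiv p.1) (memLp_coord hH1.memLp p.2)))
  have hiR : ∀ α, IntegrableOn (fun x => f x α * (η x * η x * u x α)) Q volume := fun α =>
    (memLp_coord hf α).integrable_mul (hbdd hζ.smooth.continuous hζ.hasCompactSupport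
      (memLp_coord hH1.memLp α))
  have hu2 : IntegrableOn (fun x => ‖u x‖ ^ 2) Q volume := hH1.memLp.integrable_norm_pow (by norm_num)
  have hf2 : IntegrableOn (fun x => ‖f x‖ ^ 2) Q volume := hf.integrable_norm_pow (by norm_num)
  have hD2 : IntegrableOn (fun x => ‖Du x‖ ^ 2) Q volume :=
    hH1.memLp_grad.integrable_norm_pow (by norm_num)
  have hW : ∀ x, ‖W x‖ ^ 2 ≤ d * K ^ 2 * (1 / R ^ 2 * ‖u x‖ ^ 2) := fun x => by
    rw [EuclideanSpace.norm_sq_eq, EuclideanSpace.norm_sq_eq, Fintype.sum_prod_type]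
    calc ∑ i : Fin d, ∑ α : Fin m, ‖W x (i, α)‖ ^ 2
        ≤ ∑ _i : Fin d, (K / R) ^ 2 * ∑ α : Fin m, ‖u x α‖ ^ 2 := by
          refine Finset.sum_le_sum fun i _ => ?_
          rw [Finset.mul_sum]
          refine Finset.sum_le_sum fun α _ => ?_
          simp only [W, norm_mul, mul_pow]
          gcongr
          exact hηK i x
      _ = _ := by simp; ring
  have hpoint : ∀ᵐ x ∂(volume.restrict Q), μ / 2 * (η x ^ 2 * ‖Du x‖ ^ 2) ≤
      (∑ p, F p x * (η x * η x * Du x p + pderiv p.1 (fun y => η y * η y) x * u x p.2)) +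
        2 * μ⁻¹ * (d * K ^ 2) * (1 / R ^ 2 * ‖u x‖ ^ 2) := by
    filter_upwards [ae_restrict_mem hQm, ae_restrict_of_ae (ae_contrast hω hΩb hε δ (κ := κ))]
      with x hxQ hx
    set Λ := contrast Ω ω κ ε δ x with hΛ
    have hsum : ∑ p, F p x * (η x * η x * Du x p + pderiv p.1 (fun y => η y * η y) x * u x p.2) =
        Λ * (coeffForm A (ε⁻¹ • x) (η x • Du x) (η x • Du x) +
          2 * coeffForm A (ε⁻¹ • x) (η x • Du x) (W x)) := by
      have h1 : ∑ p, F p x * (η x * η x * Du x p + pderiv p.1 (fun y => η y * η y) x * u x p.2) =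
          η x * ∑ p, F p x * (η x • Du x + (2 : ℝ) • W x) p := by
        simp only [hG, Finset.mul_sum, mul_left_comm]
      rw [h1, hFsum]
      simp only [coeffForm_eq_sum, PiLp.add_apply, PiLp.smul_apply, smul_eq_mul, Finset.mul_sum,
        Finset.sum_mul, ← Finset.sum_add_distrib]
      refine Finset.sum_congr rfl fun _ _ => Finset.sum_congr rfl fun _ _ => ?_
      ring
    -- The crux: where `Λ = δ` the field `W` vanishes, and elsewhere in `Q`, almost everywhere, `Λ =
    -- 1`. Thus `δ` never enters the error, while `Λ ≥ 1` keeps the coercive term.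
    have hΛW : 1 ≤ Λ ∧ Λ * coeffForm A (ε⁻¹ • x) (W x) (W x) ≤ μ⁻¹ * ‖W x‖ ^ 2 := by
      rcases hx (hQ hxQ) with ⟨hxD, h⟩ | h
      · obtain ⟨n, -, hn⟩ := mem_iUnion₂.1 hxD
        have hW0 : W x = 0 := PiLp.ext fun p => by simp [W, hηω n x hn]
        rw [h, hW0]
        exact ⟨hδ.le, by simp [coeffForm]⟩
      · rw [h, one_mul]
        exact ⟨le_rfl, (hA.elliptic _ _).2⟩
    have h1 := hA.young hμ (ε⁻¹ • x) (η x • Du x) (W x)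
    have h2 := (hA.elliptic (ε⁻¹ • x) (η x • Du x)).1
    rw [norm_smul, mul_pow, Real.norm_eq_abs, sq_abs] at h2
    have h3 := mul_le_mul_of_nonneg_left h1 (zero_le_one.trans hΛW.1)
    have h4 := mul_le_mul_of_nonneg_right hΛW.1 (hA.coeffForm_nonneg hμ (ε⁻¹ • x) (η x • Du x))
    have h5 := mul_le_mul_of_nonneg_left (hW x) (inv_pos.2 hμ).le
    rw [hsum]
    linarith [hΛW.2]
  have hsource : ∀ x, ∑ α, f x α * (η x * η x * u x α) ≤
      R ^ 2 * ‖f x‖ ^ 2 + 1 / R ^ 2 * ‖u x‖ ^ 2 := fun x => by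
    have h1 : ∑ α, f x α * (η x * η x * u x α) = η x ^ 2 * inner ℝ (f x) (u x) := by
      simp only [PiLp.inner_apply, Finset.mul_sum]
      refine Finset.sum_congr rfl fun α _ => ?_
      simp; ring
    have h2 := real_inner_le_norm (f x) (u x)
    have h3 : η x ^ 2 ≤ 1 := pow_le_one₀ (hη01 x).1 (hη01 x).2
    -- These weights produce the scaling `R² |f|² + R⁻² |u|²`.
    have h4 : 0 ≤ (R * ‖f x‖ - 1 / R * ‖u x‖) ^ 2 := sq_nonneg _
    have h5 : (R * ‖f x‖ - 1 / R * ‖u x‖) ^ 2 =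
        R ^ 2 * ‖f x‖ ^ 2 + 1 / R ^ 2 * ‖u x‖ ^ 2 - 2 * (‖f x‖ * ‖u x‖) := by
      field_simp; ring
    have h6 : 0 ≤ ‖f x‖ * ‖u x‖ := by positivity
    rw [h1]
    calc η x ^ 2 * inner ℝ (f x) (u x) ≤ η x ^ 2 * (‖f x‖ * ‖u x‖) := by gcongr
      _ ≤ 1 * (‖f x‖ * ‖u x‖) := by gcongr
      _ ≤ _ := by linarith
  have hηD : IntegrableOn (fun x => η x ^ 2 * ‖Du x‖ ^ 2) Q volume := by
    refine Integrable.mono' hD2 ((hη.smooth.continuous.pow 2).aestronglyMeasurable.mul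
      hD2.aestronglyMeasurable) (.of_forall fun x => ?_)
    rw [Real.norm_eq_abs, abs_of_nonneg (by positivity)]
    exact mul_le_of_le_one_left (by positivity) (pow_le_one₀ (hη01 x).1 (hη01 x).2)
  have hsub : cube x₀ (R / 2) ⊆ Q := fun x hx i => (hx i).trans (by linarith)
  have hleft : ∫ x in cube x₀ (R / 2), ‖Du x‖ ^ 2 ≤ ∫ x in Q, η x ^ 2 * ‖Du x‖ ^ 2 := by
    calc ∫ x in cube x₀ (R / 2), ‖Du x‖ ^ 2 = ∫ x in cube x₀ (R / 2), η x ^ 2 * ‖Du x‖ ^ 2 :=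
          setIntegral_congr_fun (isOpen_cube _ _).measurableSet fun x hx => by simp [hη1 x hx]
      _ ≤ _ := setIntegral_mono_set hηD (.of_forall fun x => by positivity)
          (LE.le.eventuallyLE hsub)
  have hint1 := integral_mono_ae (hηD.const_mul (μ / 2))
    ((integrable_finsetSum _ fun p _ => hiL p).add
      ((hu2.const_mul (1 / R ^ 2)).const_mul (2 * μ⁻¹ * (d * K ^ 2)))) hpoint
  have hint2 := integral_mono (integrable_finsetSum _ fun α _ => hiR α)
    ((hf2.const_mul (R ^ 2)).add (hu2.const_mul (1 / R ^ 2))) hsource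
  simp only [Pi.add_apply] at hint1 hint2
  rw [integral_add (integrable_finsetSum _ fun p _ => hiL p)
    ((hu2.const_mul (1 / R ^ 2)).const_mul _), integral_finsetSum _ fun p _ => hiL p, hmain,
    integral_const_mul, integral_const_mul, integral_const_mul] at hint1
  rw [integral_add (hf2.const_mul (R ^ 2)) (hu2.const_mul (1 / R ^ 2)),
    integral_finsetSum _ fun α _ => hiR α, integral_const_mul, integral_const_mul] at hint2
  have := mul_le_mul_of_nonneg_left hleft (half_pos hμ).le
  linarith

end

end HighContrast

theorem theorem5p7 (d m : ℕ) (hd : 2 ≤ d) (hm : 1 ≤ m)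
    (μ lam τ κ : ℝ) (hμ : 0 < μ) (hlam : lam ∈ Set.Ioo (0 : ℝ) 1) (hτ : 0 < τ) (hκ : 0 < κ)
    (ω Ω : Set (HighContrast.Vec d))
    (hω : HighContrast.InclusionAssumptions ω)
    (hΩ : HighContrast.IsLipschitzDomain Ω) (hΩb : Bornology.IsBounded Ω)
    (l : ℕ) (hl : 1 ≤ l) :
    ∃ C : ℝ, 0 < C ∧
      ∀ A : HighContrast.Coeff d m, HighContrast.CoeffAssumptions μ lam τ A →
      ∀ ε δ : ℝ, 0 < ε → ε < 1 → 1 < δ →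
      ∀ (x₀ : HighContrast.Vec d) (R : ℝ), 32 * ε ≤ R → HighContrast.cube x₀ R ⊆ Ω →
      ∀ (u : HighContrast.Vec d → HighContrast.Vec m)
        (Du : HighContrast.Vec d → HighContrast.Grad d m)
        (f : HighContrast.Vec d → HighContrast.Vec m),
        MemLp f 2 (volume.restrict (HighContrast.cube x₀ R)) →
        HighContrast.IsWeakSolution Ω ω κ ε δ A (HighContrast.cube x₀ R) u Du f →
        (∫ x in HighContrast.cube x₀ (R / 2), ‖Du x‖ ^ 2) ≤
          C * (1 / R ^ 2 * (∫ x in HighContrast.cube x₀ R, ‖u x‖ ^ 2) +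
            (ε / R) ^ (2 * l) * (∫ x in HighContrast.cube x₀ R, ‖Du x‖ ^ 2) +
            R ^ 2 * (∫ x in HighContrast.cube x₀ R, ‖f x‖ ^ 2)) := by
  obtain ⟨K, hK0, hK⟩ := HighContrast.exists_cutoff hω
  set M : ℝ := 2 * μ⁻¹ * (d * K ^ 2) + 1 with hM
  have hM1 : 1 ≤ M := le_add_of_nonneg_left (by positivity)
  -- `M` is the coefficient of the `u` term and dominates the coefficient `1` of the `f` term; `2 /
  -- μ` undoes the factor `μ / 2`. The term in `(ε / R) ^ (2 * l)` is nonnegative and is added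
  -- freely.
  refine ⟨2 / μ * M, by positivity, fun A hA ε δ hε _ hδ x₀ R hR hQ u Du f hf hu => ?_⟩
  have hR0 : 0 < R := by linarith
  obtain ⟨η, hη, hη01, hη1, hηK, hηω⟩ := hK ε R x₀ hε hR
  have h := HighContrast.caccioppoli_of_cutoff hμ hlam.1 hω.lipschitz hΩ.isOpen hΩb hA hε hδ hR0 hQ
    hf hu hη hη01 hη1 hηK hηω
  have hu0 : 0 ≤ (ε / R) ^ (2 * l) * ∫ x in HighContrast.cube x₀ R, ‖Du x‖ ^ 2 :=
    mul_nonneg (by positivity) (integral_nonneg fun _ => by positivity)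
  have hf0 : 0 ≤ R ^ 2 * ∫ x in HighContrast.cube x₀ R, ‖f x‖ ^ 2 :=
    mul_nonneg (by positivity) (integral_nonneg fun _ => by positivity)
  have h1 : μ / 2 * (∫ x in HighContrast.cube x₀ (R / 2), ‖Du x‖ ^ 2) ≤
      M * (1 / R ^ 2 * (∫ x in HighContrast.cube x₀ R, ‖u x‖ ^ 2) +
        (ε / R) ^ (2 * l) * (∫ x in HighContrast.cube x₀ R, ‖Du x‖ ^ 2) +
        R ^ 2 * (∫ x in HighContrast.cube x₀ R, ‖f x‖ ^ 2)) := by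
    refine h.trans ?_
    rw [mul_add, mul_add]
    have := mul_nonneg (zero_le_one.trans hM1) hu0
    have := le_mul_of_one_le_left hf0 hM1
    linarith
  calc ∫ x in HighContrast.cube x₀ (R / 2), ‖Du x‖ ^ 2
      = 2 / μ * (μ / 2 * ∫ x in HighContrast.cube x₀ (R / 2), ‖Du x‖ ^ 2) := by field_simp
    _ ≤ _ := by rw [mul_assoc]; gcongr
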